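/- For a sequence $(n_l)_{l\ge1}$ of positive integers, let $\bigotimes_l M_{n_l}$ denote the UHF algebra that is the $C^*$-inductive limit of $M_{n_1}(\mathbb C)\otimes\cdots\otimes M_{n_L}(\mathbb C)$, and let $\mathcal Q$ be the universal UHF algebra $M_1\otimes M_2\otimes M_3\otimes\cdots$. Fix a tensor product decomposition of $\mathcal Q$, i.e. a sequence $(n_l)$ together with a $*$-isomorphism $\theta:\bigotimes_l M_{n_l}\to\mathcal Q$. Let $\rho:\prod_{l}\mathbb Z/n_l\mathbb Z\to\prod_{l}U(M_{n_l})$ be the product of the natural representations, in which $1\in\mathbb Z/n_l\mathbb Z$ acts on $\mathbb C^{n_l}$ by the permutation matrix of the $n_l$-cycle, and let $\mathrm{Ad}:\prod_l U(M_{n_l})\to\mathrm{Aut}(\bigotimes_l M_{n_l})\cong\mathrm{Aut}(\mathcal Q)$ (the last identification being via $\theta$) be $\mathrm{Ad}((u_l)_l)=\bigotimes_l\mathrm{Ad}(u_l)$. An automorphism $\beta$ of $\mathcal Q$ is called uniformly outer if for every $a\in\mathcal Q$, every non-zero projection $p\in\mathcal Q$ and every $\varepsilon>0$ there are $k>0$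 and mutually orthogonal projections $p_1,\dots,p_k\in\mathcal Q$ with $p=p_1+\cdots+p_k$ and $\|p_j\,a\,\beta(p_j)\|<\varepsilon$ for $1\le j\le k$. An action $\alpha$ of a group $G$ on $\mathcal Q$ is called uniformly outer if $\alpha_g$ is uniformly outer for every $g\in G$ other than the identity. Let $G$ be an abelian group, let $i:G\hookrightarrow\prod_{l}\mathbb Z/n_l\mathbb Z$ be an injective homomorphism, and let $\alpha=\mathrm{Ad}\circ\rho\circ i:G\to\mathrm{Aut}(\mathcal Q)$. Then $\alpha$ is uniformly outer if and only if $i(G)\cap\bigoplus_{l}\mathbb Z/n_l\mathbb Z=0$. -/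

import Mathlib

noncomputable section

namespace UHF

open Filter Topology

/-- The index set of the standard product basis of `⊗ₗ ℂ^(n l)`. -/
abbrev Config (n : ℕ → ℕ) : Type := ∀ l, ZMod (n l)

/-- The Hilbert space `ℓ²` over all configurations. Each factor `M_{n l}` acts on the `l`-th
coordinate; this represents every finite tensor product `M_{n 0} ⊗ ⋯ ⊗ M_{n (L - 1)}` faithfully,
hence isometrically, so the norm closure of their union is the C⋆-inductive limit. -/
abbrev Hil (n : ℕ → ℕ) : Type := lp (fun _ : Config n => ℂ) 2

/-- The matrix algebra `M_k(ℂ)`, with rows and columns indexed by `ℤ/k`. -/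
abbrev Mat (k : ℕ) : Type := Matrix (ZMod k) (ZMod k) ℂ

section Site

variable {n : ℕ → ℕ}

theorem memlp_weighted (c : Config n → ℂ) (C : ℝ) (hc : ∀ x, ‖c x‖ ≤ C)
    (e : Config n ≃ Config n) (f : Hil n) :
    Memℓp (fun x => c x * f (e x)) 2 := by
  have h2 : (0 : ℝ) < (2 : ENNReal).toReal := by norm_num
  have hf : Summable fun x => ‖f (e x)‖ ^ (2 : ENNReal).toReal :=
    ((lp.memℓp f).summable h2).comp_injective e.injective
  refine memℓp_gen (Summable.of_nonneg_of_le (fun x => by positivity) (fun x => ?_)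
    (hf.mul_left (C ^ (2 : ENNReal).toReal)))
  rw [norm_mul, Real.mul_rpow (norm_nonneg _) (norm_nonneg _)]
  gcongr
  exact hc x

theorem norm_weighted_le (c : Config n → ℂ) (C : ℝ) (hc : ∀ x, ‖c x‖ ≤ C)
    (e : Config n ≃ Config n) (f : Hil n) :
    ‖(⟨fun x => c x * f (e x), memlp_weighted c C hc e f⟩ : Hil n)‖ ≤ C * ‖f‖ := by
  have h2 : (0 : ℝ) < (2 : ENNReal).toReal := by norm_num
  have hC : 0 ≤ C := (norm_nonneg _).trans (hc 0)
  have hf := ((e.hasSum_iff).2 (lp.hasSum_norm h2 f)).mul_left (C ^ (2 : ENNReal).toReal)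
  refine lp.norm_le_of_tsum_le h2 (by positivity) ?_
  rw [Real.mul_rpow hC (norm_nonneg _), ← hf.tsum_eq]
  refine Summable.tsum_le_tsum (fun x => ?_)
    ((memlp_weighted c C hc e f).summable h2) hf.summable
  simp only [Function.comp_apply, norm_mul]
  rw [Real.mul_rpow (norm_nonneg _) (norm_nonneg _)]
  gcongr
  exact hc x

theorem update_eq_add_single (x : Config n) (l : ℕ) (d : ZMod (n l)) :
    Function.update x l (x l + d) = x + Pi.single l d := by
  ext k
  by_cases h : k = l
  · subst h; simp
  · simp [h]

variable [∀ l, NeZero (n l)]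

/-- The sum of the absolute values of the entries. -/
def entryBound {k : ℕ} [NeZero k] (m : Mat k) : ℝ := ∑ i, ∑ j, ‖m i j‖

theorem norm_entry_le {k : ℕ} [NeZero k] (m : Mat k) (i j : ZMod k) :
    ‖m i j‖ ≤ entryBound m :=
  (Finset.single_le_sum (f := fun j => ‖m i j‖) (fun _ _ => norm_nonneg _)
    (Finset.mem_univ j)).trans
    (Finset.single_le_sum (f := fun i => ∑ j, ‖m i j‖)
      (fun _ _ => Finset.sum_nonneg fun _ _ => norm_nonneg _) (Finset.mem_univ i))

/-- One diagonal of the matrix `m`, acting on the `l`-th coordinate. -/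
def diagTerm (l : ℕ) (m : Mat (n l)) (d : ZMod (n l)) (f : Hil n) : Hil n :=
  ⟨fun x => m (x l) (x l + d) * f (Equiv.addRight (Pi.single l d : Config n) x),
    memlp_weighted _ (entryBound m) (fun _ => norm_entry_le _ _ _) _ f⟩

theorem site_fun_eq (l : ℕ) (m : Mat (n l)) (f : Hil n) :
    (fun x : Config n => ∑ j, m (x l) j * f (Function.update x l j)) =
      ((∑ d, diagTerm l m d f : Hil n) : Config n → ℂ) := by
  ext x
  rw [lp.coeFn_sum, Finset.sum_apply, ← Equiv.sum_comp (Equiv.addLeft (x l))]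
  refine Finset.sum_congr rfl fun d _ => ?_
  simp only [diagTerm, Equiv.coe_addLeft, Equiv.coe_addRight, update_eq_add_single]

/-- The matrix `m` acting on the `l`-th coordinate: this is `1 ⊗ ⋯ ⊗ 1 ⊗ m ⊗ 1 ⊗ ⋯`. -/
def siteOp (l : ℕ) (m : Mat (n l)) : Hil n →L[ℂ] Hil n :=
  LinearMap.mkContinuousOfExistsBound
    { toFun := fun f => ⟨fun x => ∑ j, m (x l) j * f (Function.update x l j),
        site_fun_eq l m f ▸ (∑ d, diagTerm l m d f : Hil n).2⟩
      map_add' := fun f g => by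
        ext x
        simp only [lp.coeFn_add, Pi.add_apply, mul_add, Finset.sum_add_distrib]
      map_smul' := fun c f => by
        ext x
        simp only [lp.coeFn_smul, Pi.smul_apply, smul_eq_mul, Finset.mul_sum, mul_left_comm,
          RingHom.id_apply] }
    ⟨Fintype.card (ZMod (n l)) * entryBound m, fun f => by
      have h : (⟨fun x => ∑ j, m (x l) j * f (Function.update x l j),
          site_fun_eq l m f ▸ (∑ d, diagTerm l m d f : Hil n).2⟩ : Hil n) =
          ∑ d, diagTerm l m d f := Subtype.ext (site_fun_eq l m f)
      simp only [LinearMap.coe_mk, AddHom.coe_mk]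
      rw [h]
      refine (norm_sum_le _ _).trans ?_
      refine (Finset.sum_le_sum fun d _ => norm_weighted_le _ (entryBound m)
        (fun _ => norm_entry_le _ _ _) _ f).trans ?_
      simp [mul_assoc]⟩

theorem siteOp_apply (l : ℕ) (m : Mat (n l)) (f : Hil n) (x : Config n) :
    siteOp l m f x = ∑ j, m (x l) j * f (Function.update x l j) := rfl

theorem siteOp_eq_sum (l : ℕ) (m : Mat (n l)) (f : Hil n) :
    siteOp l m f = ∑ d, diagTerm l m d f := Subtype.ext (site_fun_eq l m f)

theorem inner_diagTerm (l : ℕ) (m : Mat (n l)) (d : ZMod (n l)) (f g : Hil n) :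
    inner ℂ (diagTerm l (star m) d f) g = inner ℂ f (diagTerm l m (-d) g) := by
  rw [lp.inner_eq_tsum, lp.inner_eq_tsum,
    ← (Equiv.addRight (Pi.single l d : Config n)).tsum_eq
      (fun x => inner ℂ (f x) (diagTerm l m (-d) g x))]
  refine tsum_congr fun x => ?_
  have h : x + Pi.single l d + Pi.single l (-d) = x := by
    rw [add_assoc, ← Pi.single_add]; simp
  simp [diagTerm, h, Matrix.star_apply]
  ring

/-- The inclusion of the `l`-th tensor factor into the bounded operators. -/
def siteHom (n : ℕ → ℕ) [∀ l, NeZero (n l)] (l : ℕ) :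
    Mat (n l) →⋆ₐ[ℂ] (Hil n →L[ℂ] Hil n) where
  toFun := siteOp l
  map_one' := by
    ext f x
    simp [siteOp_apply, Matrix.one_apply]
  map_mul' a b := by
    ext f x
    change _ = siteOp l a (siteOp l b f) x
    simp only [siteOp_apply, Matrix.mul_apply, Finset.mul_sum,
      Finset.sum_mul, Function.update_self, Function.update_idem]
    rw [Finset.sum_comm]
    simp [mul_assoc]
  map_zero' := by
    ext f x
    simp [siteOp_apply]
  map_add' a b := by
    ext f x
    simp [siteOp_apply, add_mul, Finset.sum_add_distrib]
  commutes' c := by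
    ext f x
    simp [siteOp_apply, Algebra.algebraMap_eq_smul_one, Matrix.one_apply]
  map_star' m := by
    rw [ContinuousLinearMap.star_eq_adjoint, ContinuousLinearMap.eq_adjoint_iff]
    intro f g
    rw [siteOp_eq_sum, siteOp_eq_sum, sum_inner, inner_sum, ← Equiv.sum_comp (Equiv.neg _)]
    refine Finset.sum_congr rfl fun d _ => ?_
    simp [inner_diagTerm]

theorem siteHom_commute {k l : ℕ} (h : k ≠ l) (a : Mat (n k)) (b : Mat (n l)) :
    Commute (siteHom n k a) (siteHom n l b) := by
  ext f x
  change siteOp k a (siteOp l b f) x = siteOp l b (siteOp k a f) x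
  simp only [siteOp_apply, Finset.mul_sum, Function.update_of_ne h, Function.update_of_ne h.symm]
  rw [Finset.sum_comm]
  refine Finset.sum_congr rfl fun j _ => Finset.sum_congr rfl fun i _ => ?_
  rw [Function.update_comm h]
  ring

end Site

/-- The norm closure of the `*`-algebra generated by the commuting unital copies of the matrix
algebras `M_{n l}`. -/
def tensorSubalgebra (n : ℕ → ℕ) [∀ l, NeZero (n l)] :
    StarSubalgebra ℂ (Hil n →L[ℂ] Hil n) :=
  (⨆ l, (siteHom n l).range).topologicalClosure

instance isClosed_tensorSubalgebra (n : ℕ → ℕ) [∀ l, NeZero (n l)] :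
    IsClosed (tensorSubalgebra n : Set (Hil n →L[ℂ] Hil n)) :=
  StarSubalgebra.isClosed_topologicalClosure _

/-- The UHF algebra `⊗ₗ M_{n l}`, as a C⋆-algebra. -/
def TensorAlg (n : ℕ → ℕ) [∀ l, NeZero (n l)] : Type := tensorSubalgebra n

instance instCStarAlgebraTensorAlg (n : ℕ → ℕ) [∀ l, NeZero (n l)] : CStarAlgebra (TensorAlg n) :=
  inferInstanceAs (CStarAlgebra (tensorSubalgebra n))

/-- The inclusion of `⊗ₗ M_{n l}` into the bounded operators. -/
def toOp (n : ℕ → ℕ) [∀ l, NeZero (n l)] : TensorAlg n →⋆ₐ[ℂ] (Hil n →L[ℂ] Hil n) :=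
  (tensorSubalgebra n).subtype

theorem toOp_injective (n : ℕ → ℕ) [∀ l, NeZero (n l)] : Function.Injective (toOp n) :=
  Subtype.val_injective

theorem norm_toOp {n : ℕ → ℕ} [∀ l, NeZero (n l)] (x : TensorAlg n) : ‖toOp n x‖ = ‖x‖ := rfl

/-- The inclusion of the `l`-th tensor factor `M_{n l}` into `⊗ₗ M_{n l}`. -/
def factor (n : ℕ → ℕ) [∀ l, NeZero (n l)] (l : ℕ) : Mat (n l) →⋆ₐ[ℂ] TensorAlg n :=
  (siteHom n l).codRestrict (tensorSubalgebra n) fun m =>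
    StarSubalgebra.le_topologicalClosure _ (le_iSup (fun l => (siteHom n l).range) l ⟨m, rfl⟩)

theorem toOp_factor {n : ℕ → ℕ} [∀ l, NeZero (n l)] (l : ℕ) (m : Mat (n l)) :
    toOp n (factor n l m) = siteHom n l m := rfl

section Ad

variable {n : ℕ → ℕ} [∀ l, NeZero (n l)]

theorem factor_commute {k l : ℕ} (h : k ≠ l) (a : Mat (n k)) (b : Mat (n l)) :
    Commute (factor n k a) (factor n l b) :=
  toOp_injective n (by
    rw [map_mul, map_mul, toOp_factor, toOp_factor, (siteHom_commute h a b).eq])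

/-- The map of unitary groups induced by the inclusion of the `l`-th tensor factor. -/
def factorUnitary (n : ℕ → ℕ) [∀ l, NeZero (n l)] (l : ℕ) :
    unitary (Mat (n l)) →* unitary (TensorAlg n) where
  toFun v := ⟨factor n l v, Unitary.map_mem (factor n l) v.2⟩
  map_one' := Subtype.ext (map_one (factor n l))
  map_mul' _ _ := Subtype.ext (map_mul (factor n l) _ _)

/-- The unitary `u 0 ⊗ ⋯ ⊗ u (L - 1) ⊗ 1 ⊗ 1 ⊗ ⋯`. -/
def partialUnitary (u : ∀ l, unitary (Mat (n l))) : ℕ → unitary (TensorAlg n)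
  | 0 => 1
  | L + 1 => partialUnitary u L * factorUnitary n L (u L)

theorem partialUnitary_commute (u : ∀ l, unitary (Mat (n l))) {L l : ℕ} (h : L ≤ l)
    (b : Mat (n l)) : Commute (partialUnitary u L : TensorAlg n) (factor n l b) := by
  induction L with
  | zero => exact Commute.one_left _
  | succ L ih =>
    exact (ih (by omega)).mul_left
      (factor_commute (by omega) (u L : Mat (n L)) b)

theorem partialUnitary_one (L : ℕ) :
    partialUnitary (1 : ∀ l, unitary (Mat (n l))) L = 1 := by
  induction L with
  | zero => rfl
  | succ L ih => rw [partialUnitary, ih]; simp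

theorem partialUnitary_mul (u v : ∀ l, unitary (Mat (n l))) (L : ℕ) :
    partialUnitary (u * v) L = partialUnitary u L * partialUnitary v L := by
  induction L with
  | zero => simp [partialUnitary]
  | succ L ih =>
    have hc : Commute (factorUnitary n L (u L))
        (partialUnitary v L) :=
      Subtype.ext (partialUnitary_commute v le_rfl (u L : Mat (n L))).symm.eq
    simp only [partialUnitary, ih, Pi.mul_apply, map_mul]
    rw [mul_assoc, mul_assoc, ← mul_assoc (partialUnitary v L), ← hc.eq, mul_assoc]

/-- Conjugation by `u 0 ⊗ ⋯ ⊗ u (L - 1) ⊗ 1 ⊗ 1 ⊗ ⋯`. -/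
def partialAd (u : ∀ l, unitary (Mat (n l))) (L : ℕ) : TensorAlg n ≃⋆ₐ[ℂ] TensorAlg n :=
  Unitary.conjStarAlgAut ℂ (TensorAlg n) (partialUnitary u L)

theorem norm_partialAd (u : ∀ l, unitary (Mat (n l))) (L : ℕ) (x : TensorAlg n) :
    ‖partialAd u L x‖ = ‖x‖ := by
  rw [partialAd, Unitary.conjStarAlgAut_apply, ← Unitary.coe_star,
    CStarRing.norm_mul_coe_unitary, CStarRing.norm_coe_unitary_mul]

/-- The operators commuting with all but finitely many tensor factors. -/
def localOps (n : ℕ → ℕ) [∀ l, NeZero (n l)] : StarSubalgebra ℂ (Hil n →L[ℂ] Hil n) where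
  carrier := {T | ∃ L, ∀ l, L ≤ l → ∀ m, Commute (siteHom n l m) T}
  mul_mem' := by
    rintro a b ⟨L, hL⟩ ⟨M, hM⟩
    exact ⟨max L M, fun l hl m => (hL l (le_of_max_le_left hl) m).mul_right
      (hM l (le_of_max_le_right hl) m)⟩
  add_mem' := by
    rintro a b ⟨L, hL⟩ ⟨M, hM⟩
    exact ⟨max L M, fun l hl m => (hL l (le_of_max_le_left hl) m).add_right
      (hM l (le_of_max_le_right hl) m)⟩
  algebraMap_mem' c := ⟨0, fun _ _ _ => (Algebra.commutes c _).symm⟩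
  star_mem' := by
    rintro a ⟨L, hL⟩
    refine ⟨L, fun l hl m => ?_⟩
    have h := (hL l hl (star m)).star_star
    rwa [← map_star, star_star] at h

theorem iSup_range_le_localOps : ⨆ l, (siteHom n l).range ≤ localOps n := by
  refine iSup_le fun k => ?_
  rintro _ ⟨a, rfl⟩
  exact ⟨k + 1, fun l hl m => siteHom_commute (by omega) m a⟩

theorem partialAd_eq_of_local (u : ∀ l, unitary (Mat (n l))) {x : TensorAlg n} {L : ℕ}
    (hx : ∀ l, L ≤ l → ∀ m, Commute (siteHom n l m) (toOp n x)) {M : ℕ}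
    (hM : L ≤ M) : partialAd u M x = partialAd u L x := by
  induction M, hM using Nat.le_induction with
  | base => rfl
  | succ M hM ih =>
    rw [← ih]
    have hc : Commute (factor n M (u M : Mat (n M))) x :=
      toOp_injective n (by rw [map_mul, map_mul, toOp_factor, (hx M hM _).eq])
    have hv : (partialUnitary u (M + 1) : TensorAlg n) =
        partialUnitary u M * factor n M (u M : Mat (n M)) := rfl
    have hu : (factor n M (u M : Mat (n M))) * star (factor n M (u M : Mat (n M))) = 1 :=
      Unitary.mul_star_self_of_mem (factorUnitary n M (u M)).2
    rw [partialAd, partialAd, Unitary.conjStarAlgAut_apply, Unitary.conjStarAlgAut_apply, hv]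
    generalize factor n M (u M : Mat (n M)) = v at hc hu
    generalize (partialUnitary u M : TensorAlg n) = w
    rw [star_mul, mul_assoc w v x, hc.eq, ← mul_assoc w x v, mul_assoc (w * x) v,
      ← mul_assoc v, hu, one_mul]

theorem cauchySeq_partialAd (u : ∀ l, unitary (Mat (n l))) (x : TensorAlg n) :
    CauchySeq fun L => partialAd u L x := by
  rw [Metric.cauchySeq_iff']
  intro ε hε
  obtain ⟨b, hb, hxb⟩ := Metric.mem_closure_iff.1
    (show toOp n x ∈ closure ((⨆ l, (siteHom n l).range :
      StarSubalgebra ℂ (Hil n →L[ℂ] Hil n)) : Set (Hil n →L[ℂ] Hil n)) from x.2) (ε / 2)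
      (half_pos hε)
  obtain ⟨L, hL⟩ := iSup_range_le_localOps hb
  let b' : TensorAlg n := ⟨b, StarSubalgebra.le_topologicalClosure _ hb⟩
  have hd : ∀ M, dist (partialAd u M x) (partialAd u M b') < ε / 2 := fun M => by
    rw [dist_eq_norm, ← map_sub, norm_partialAd, ← norm_toOp, map_sub, ← dist_eq_norm]
    exact hxb
  refine ⟨L, fun M hM => ?_⟩
  have h1 := hd M
  rw [partialAd_eq_of_local u (x := b') hL hM] at h1
  calc dist (partialAd u M x) (partialAd u L x)
      ≤ dist (partialAd u M x) (partialAd u L b') + dist (partialAd u L x) (partialAd u L b') :=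
        dist_triangle_right _ _ _
    _ < ε / 2 + ε / 2 := add_lt_add h1 (hd L)
    _ = ε := add_halves ε

/-- The infinite product `⊗ₗ Ad (u l)`, as the pointwise norm limit of conjugation by
`u 0 ⊗ ⋯ ⊗ u (L - 1) ⊗ 1 ⊗ 1 ⊗ ⋯`. -/
def adFun (u : ∀ l, unitary (Mat (n l))) (x : TensorAlg n) : TensorAlg n :=
  limUnder atTop fun L => partialAd u L x

theorem tendsto_partialAd (u : ∀ l, unitary (Mat (n l))) (x : TensorAlg n) :
    Tendsto (fun L => partialAd u L x) atTop (𝓝 (adFun u x)) :=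
  (cauchySeq_partialAd u x).tendsto_limUnder

theorem adFun_eq {u : ∀ l, unitary (Mat (n l))} {x y : TensorAlg n}
    (h : Tendsto (fun L => partialAd u L x) atTop (𝓝 y)) : adFun u x = y :=
  tendsto_nhds_unique (tendsto_partialAd u x) h

theorem adFun_one (x : TensorAlg n) : adFun 1 x = x :=
  adFun_eq (by simp [partialAd, partialUnitary_one])

theorem adFun_mul (u v : ∀ l, unitary (Mat (n l))) (x : TensorAlg n) :
    adFun (u * v) x = adFun u (adFun v x) := by
  refine adFun_eq ?_
  refine (tendsto_iff_of_dist ?_).2 (tendsto_partialAd u (adFun v x))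
  have h := tendsto_iff_dist_tendsto_zero.1 (tendsto_partialAd v x)
  refine h.congr fun L => ?_
  have : partialAd (u * v) L x = partialAd u L (partialAd v L x) := by
    simp only [partialAd, partialUnitary_mul, map_mul, StarAlgEquiv.mul_apply]
  rw [this, dist_eq_norm, dist_eq_norm, ← map_sub, norm_partialAd]

/-- The homomorphism `Ad : ∏ₗ U(M_{n l}) → Aut (⊗ₗ M_{n l})`. -/
def Ad (n : ℕ → ℕ) [∀ l, NeZero (n l)] :
    (∀ l, unitary (Mat (n l))) →* (TensorAlg n ≃⋆ₐ[ℂ] TensorAlg n) where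
  toFun u :=
    { toFun := adFun u
      invFun := adFun u⁻¹
      left_inv := fun x => by rw [← adFun_mul, inv_mul_cancel, adFun_one]
      right_inv := fun x => by rw [← adFun_mul, mul_inv_cancel, adFun_one]
      map_mul' := fun x y => adFun_eq (by
        simpa only [map_mul] using (tendsto_partialAd u x).mul (tendsto_partialAd u y))
      map_add' := fun x y => adFun_eq (by
        simpa only [map_add] using (tendsto_partialAd u x).add (tendsto_partialAd u y))
      map_star' := fun x => adFun_eq (by
        simpa only [map_star] using (tendsto_partialAd u x).star)
      map_smul' := fun c x => adFun_eq (by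
        simpa only [map_smul] using (tendsto_partialAd u x).const_smul c) }
  map_one' := StarAlgEquiv.ext fun x => adFun_one x
  map_mul' u v := StarAlgEquiv.ext fun x => adFun_mul u v x

end Ad

/-- The natural representation of `ℤ/k` on `ℂ^k`: the element `g` acts by the permutation matrix
of the translation `j ↦ g + j`, so that `1` acts by the `k`-cycle. -/
def cyclicRep (k : ℕ) [NeZero k] : Multiplicative (ZMod k) →* unitary (Mat k) where
  toFun g := ⟨Matrix.of fun i j => if i = g.toAdd + j then 1 else 0, by
    rw [Unitary.mem_iff]
    constructor
    · ext i j
      simp [Matrix.mul_apply, Matrix.one_apply, Matrix.star_apply, apply_ite, eq_comm]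
    · ext i j
      have h : ∀ a x : ZMod k, a = g.toAdd + x ↔ x = a - g.toAdd := fun a x => by
        rw [eq_sub_iff_add_eq', eq_comm]
      simp [Matrix.mul_apply, Matrix.one_apply, Matrix.star_apply, h, eq_comm]⟩
  map_one' := by ext i j; simp [Matrix.one_apply]
  map_mul' g h := by
    ext i j
    simp [Matrix.mul_apply, add_assoc]

/-- The product of the natural representations, `ρ : ∏ₗ ℤ/(n l) → ∏ₗ U(M_{n l})`. -/
def productRep (n : ℕ → ℕ) [∀ l, NeZero (n l)] :
    Multiplicative (∀ l, ZMod (n l)) →* ∀ l, unitary (Mat (n l)) where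
  toFun g l := cyclicRep (n l) (Multiplicative.ofAdd (g.toAdd l))
  map_one' := by ext1 l; exact map_one (cyclicRep (n l))
  map_mul' g h := by ext1 l; exact map_mul (cyclicRep (n l)) _ _

/-- The universal UHF algebra, realized as `M_1 ⊗ M_2 ⊗ M_3 ⊗ ⋯`: every positive integer divides
`1 · 2 ⋯ L` for large `L`, so its supernatural number is `∏ p ^ ∞`. -/
abbrev Q : Type := TensorAlg fun l => l + 1

/-- The isomorphism `Aut A → Aut B` induced by an isomorphism `θ : A → B`. -/
def autCongr {A B : Type*} [CStarAlgebra A] [CStarAlgebra B] (θ : A ≃⋆ₐ[ℂ] B) :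
    (A ≃⋆ₐ[ℂ] A) →* (B ≃⋆ₐ[ℂ] B) where
  toFun f := θ.symm.trans (f.trans θ)
  map_one' := by ext; simp
  map_mul' f g := by ext; simp

/-- For a tensor product decomposition `θ : ⊗ₗ M_{n l} ≅ Q`, the action
`G → ∏ₗ ℤ/(n l) → ∏ₗ U(M_{n l}) → Aut Q`. -/
def modelAction (n : ℕ → ℕ) [∀ l, NeZero (n l)] (θ : TensorAlg n ≃⋆ₐ[ℂ] Q)
    {G : Type*} [AddCommGroup G] (i : G →+ ∀ l, ZMod (n l)) :
    Multiplicative G →* (Q ≃⋆ₐ[ℂ] Q) :=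
  (autCongr θ).comp ((Ad n).comp ((productRep n).comp (AddMonoidHom.toMultiplicative i)))

/-- Uniform outerness of an automorphism: every non-zero projection `p` is, for any `a` and `ε`, a
sum of mutually orthogonal projections `q j` with `‖q j * a * α (q j)‖ < ε`. -/
def IsUniformlyOuter {A : Type*} [CStarAlgebra A] (α : A ≃⋆ₐ[ℂ] A) : Prop :=
  ∀ a p : A, IsStarProjection p → p ≠ 0 → ∀ ε : ℝ, 0 < ε →
    ∃ k : ℕ, 0 < k ∧ ∃ q : Fin k → A,
      (∀ j, IsStarProjection (q j)) ∧
      (∀ j j', j ≠ j' → q j * q j' = 0) ∧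
      p = ∑ j, q j ∧
      ∀ j, ‖q j * a * α (q j)‖ < ε

/-- An action is uniformly outer if every non-identity element acts by a uniformly outer
automorphism. -/
def IsUniformlyOuterAction {A : Type*} [CStarAlgebra A] {Γ : Type*} [Group Γ]
    (α : Γ →* (A ≃⋆ₐ[ℂ] A)) : Prop :=
  ∀ g : Γ, g ≠ 1 → IsUniformlyOuter (α g)

end UHF

end

/-! Transported along `θ`, each `α_g` is an infinite product of conjugations by cyclic shifts. It is
uniformly outer exactly when infinitely many coordinates of `i g` are non-zero; injectivity of `i`
turns this criterion for each element into the statement about subgroups.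

If the coordinates vanish from some index on, the product of conjugations is conjugation by a single
unitary `w`. Testing the definition with `a = w*`, `p = 1`, `ε = 1` gives `‖q_j w* α(q_j)‖ = ‖q_j
w*‖ = ‖q_j‖ < 1`, so every projection `q_j` is zero and they cannot sum to `1`
(`not_isUniformlyOuter_of_inner`).

Otherwise, approximate `a` and `p` by elements commuting with all far-out factors, and choose a
far-out site `l` where the shift is non-trivial. The diagonal matrix units at `l` form a partition
of unity that commutes with both approximants, and the shift carries each one to an orthogonal one.
The approximant of `p` need not be a projection, and the pieces must sum to `p` exactly.
`isUniformlyOuter_of_partition` repairs this: functional calculus yields a projection `q` near `p`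
still commuting with the partition, and a unitary near `1` conjugates `q`, together with its pieces,
onto `p`. -/

namespace UHF

/-! ### Perturbation of projections in a C⋆-algebra -/

section Perturbation

variable {A : Type*} [CStarAlgebra A]

/-- A self-adjoint element close to a projection has a spectral projection close to it. -/
theorem exists_isStarProjection_near {p b : A} (hp : IsStarProjection p) (hb : IsSelfAdjoint b)
    {δ : ℝ} (hδ : δ ≤ 1 / 40) (hpb : ‖p - b‖ ≤ δ) :
    ∃ q : A, IsStarProjection q ∧ ‖p - q‖ ≤ 7 * δ ∧ ∀ x, Commute b x → Commute q x := by
  have hδ0 : 0 ≤ δ := (norm_nonneg _).trans hpb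
  -- In the expansion below the quadratic term is at most `δ / 40`, and the three linear terms are
  -- at most `δ` each.
  have hbb : ‖b * b - b‖ ≤ 4 * δ := by
    have hpp : p * p = p := hp.isIdempotentElem
    have h : b * b - b = (p - b) * (p - b) - p * (p - b) - (p - b) * p + (p - b) := by
      simp only [mul_sub, sub_mul, hpp]; abel
    have hp1 : ‖p‖ ≤ 1 := hp.norm_le
    rw [h]
    calc _ ≤ ‖p - b‖ * ‖p - b‖ + ‖p‖ * ‖p - b‖ + ‖p - b‖ * ‖p‖ + ‖p - b‖ := by
          refine (norm_add_le _ _).trans (add_le_add_left ?_ _)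
          refine (norm_sub_le _ _).trans (add_le_add ?_ (norm_mul_le _ _))
          exact (norm_sub_le _ _).trans (add_le_add (norm_mul_le _ _) (norm_mul_le _ _))
      _ ≤ δ * (1 / 40) + 1 * δ + δ * 1 + δ := by
          gcongr
          exact hpb.trans hδ
      _ ≤ 4 * δ := by linarith
  have hspec : ∀ x ∈ spectrum ℝ b, |x * x - x| ≤ 4 * δ := fun x hx => by
    have h := norm_apply_le_norm_cfc (fun x : ℝ => x * x - x) b hx
    rw [cfc_sub (fun x : ℝ => x * x) (fun x => x) b, cfc_mul (fun x : ℝ => x) (fun x => x) b,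
      cfc_id' ℝ b] at h
    exact h.trans hbb
  -- A continuous ramp from `0` at `1/4` to `1` at `3/4`. The spectrum misses the open interval
  -- between, where `|x² - x| > 3/16 > 1/10 ≥ 4δ`, so `f` takes only the values `0` and `1` on it.
  -- Off the gap one of `|x|`, `|x - 1|` is at least `3/4`, so the other is at most `16δ/3 ≤ 6δ`.
  let f : ℝ → ℝ := fun x => max 0 (min 1 (2 * x - 1 / 2))
  have hf : Continuous f := by fun_prop
  have hcase : ∀ x ∈ spectrum ℝ b, (f x = 0 ∨ f x = 1) ∧ |x - f x| ≤ 6 * δ := fun x hx => by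
    have h := abs_le.1 (hspec x hx)
    rcases le_or_gt x (1 / 4) with h1 | h1
    · have hf0 : f x = 0 := max_eq_left ((min_le_right _ _).trans (by linarith))
      refine ⟨Or.inl hf0, ?_⟩
      rw [hf0, abs_le]
      constructor <;> nlinarith
    rcases lt_or_ge x (3 / 4) with h2 | h2
    · nlinarith
    · have hf1 : f x = 1 := by
        simp only [f]
        rw [min_eq_left (by linarith), max_eq_right zero_le_one]
      refine ⟨Or.inr hf1, ?_⟩
      rw [hf1, abs_le]
      constructor <;> nlinarith
  refine ⟨cfc f b, ⟨?_, cfc_predicate f b⟩, ?_, fun x hx => hx.cfc_real f⟩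
  · rw [IsIdempotentElem, ← cfc_mul f f b]
    refine cfc_congr fun x hx => ?_
    rcases (hcase x hx).1 with h | h <;> simp [h]
  · have h : ‖b - cfc f b‖ ≤ 6 * δ := by
      nth_rewrite 1 [← cfc_id' ℝ b]
      rw [← cfc_sub (fun x : ℝ => x) f b]
      exact norm_cfc_le (by linarith) fun x hx => (hcase x hx).2
    calc _ ≤ ‖p - b‖ + ‖b - cfc f b‖ := norm_sub_le_norm_sub_add_norm_sub _ _ _
      _ ≤ 7 * δ := by linarith

/-- A self-adjoint element close to `1` has an inverse square root close to `1`. -/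
theorem exists_inv_sqrt_near_one {h : A} (hsa : IsSelfAdjoint h) {η : ℝ} (hη : η ≤ 1 / 2)
    (hh : ‖h - 1‖ ≤ η) :
    ∃ r : A, star r = r ∧ r * h * r = 1 ∧ ‖r - 1‖ ≤ η ∧ ∀ x, Commute h x → Commute r x := by
  have hspec : ∀ x ∈ spectrum ℝ h, |x - 1| ≤ η := fun x hx => by
    have h1 := norm_apply_le_norm_cfc (fun x : ℝ => x - 1) h hx
    rw [cfc_sub (fun x : ℝ => x) (fun _ => 1) h, cfc_id' ℝ h, cfc_const_one ℝ h] at h1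
    exact h1.trans hh
  have hhalf : ∀ x ∈ spectrum ℝ h, 1 / 2 ≤ x := fun x hx => by
    linarith [(abs_le.1 (hspec x hx)).1]
  -- The truncation at `1/2` makes `x ↦ x^(-1/2)` continuous on all of `ℝ` without changing it on
  -- the spectrum.
  let f : ℝ → ℝ := fun x => (√(max x (1 / 2)))⁻¹
  have hf : Continuous f := by
    refine Continuous.inv₀ (by fun_prop) fun x => (Real.sqrt_pos.2 ?_).ne'
    exact lt_of_lt_of_le one_half_pos (le_max_right _ _)
  have hfc : ContinuousOn f (spectrum ℝ h) := hf.continuousOn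
  have hfx : ContinuousOn (fun x => f x * x) (spectrum ℝ h) := hfc.mul continuousOn_id
  refine ⟨cfc f h, cfc_predicate f h, ?_, ?_, fun x hx => hx.cfc_real f⟩
  · have h1 : cfc f h * h = cfc (fun x => f x * x) h := by
      rw [cfc_mul f (fun x => x) h hfc continuousOn_id, cfc_id' ℝ h]
    rw [h1, ← cfc_mul (fun x => f x * x) f h hfx hfc, ← cfc_const_one ℝ h]
    refine cfc_congr fun x hx => ?_
    have hx0 := hhalf x hx
    have hs : 0 < √x := Real.sqrt_pos.2 (by linarith)
    simp only [f, max_eq_left hx0]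
    field_simp
    rw [Real.sq_sqrt (by linarith)]
  · rw [← cfc_const_one ℝ h, ← cfc_sub f (fun _ => 1) h hfc continuousOn_const]
    refine norm_cfc_le ((norm_nonneg _).trans hh) fun x hx => le_trans ?_ (hspec x hx)
    have hx0 := hhalf x hx
    have hs : 1 / 2 ≤ √x := Real.le_sqrt_of_sq_le (by linarith)
    have hsq : √x * √x = x := Real.mul_self_sqrt (by linarith)
    simp only [f, max_eq_left hx0]
    -- The denominator `√x (√x + 1) = x + √x` is at least `1`, since `x` and `√x` are both at least
    -- `1/2`.
    have he : (√x)⁻¹ - 1 = -((x - 1) * (√x * (√x + 1))⁻¹) := by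
      have h0 : √x ≠ 0 := by linarith
      have h1 : √x + 1 ≠ 0 := by linarith
      rw [eq_neg_iff_add_eq_zero]
      field_simp
      linear_combination -hsq
    rw [he, norm_neg, norm_mul, Real.norm_eq_abs, Real.norm_eq_abs]
    refine mul_le_of_le_one_right (abs_nonneg _) ?_
    rw [abs_of_nonneg (by positivity)]
    refine inv_le_one_of_one_le₀ ?_
    nlinarith

/-- Close projections are conjugate by a unitary close to `1`. -/
theorem exists_unitary_conj_eq {p q : A} (hp : IsStarProjection p) (hq : IsStarProjection q)
    {δ : ℝ} (hδ : δ ≤ 1 / 2) (hpq : ‖p - q‖ ≤ δ) :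
    ∃ u ∈ unitary A, u * q * star u = p ∧ ‖u - 1‖ ≤ 3 * δ := by
  have hδ0 : 0 ≤ δ := (norm_nonneg _).trans hpq
  have hpp : p * p = p := hp.isIdempotentElem
  have hqq : q * q = q := hq.isIdempotentElem
  have hps : star p = p := hp.isSelfAdjoint
  have hqs : star q = q := hq.isSelfAdjoint
  have hp' : ∀ x, p * (p * x) = p * x := fun x => by rw [← mul_assoc, hpp]
  have hq' : ∀ x, q * (q * x) = q * x := fun x => by rw [← mul_assoc, hqq]
  set h : A := 1 - (p - q) * (p - q) with hh
  have hsa : IsSelfAdjoint h := by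
    simp only [IsSelfAdjoint, hh, star_sub, star_one, star_mul, hps, hqs]
  -- `z` intertwines `q` and `p`, and `z* z = z z* = h` commutes with `q`. The unitary `z h^(-1/2)`
  -- from its polar decomposition therefore still intertwines them.
  set z : A := p * q + (1 - p) * (1 - q) with hz
  have hzz : star z * z = h := by
    simp only [hz, hh, star_add, star_mul, star_sub, star_one, hps, hqs]
    simp only [mul_add, add_mul, mul_sub, sub_mul, mul_one, one_mul, mul_assoc, hpp, hqq, hp']
    abel
  have hzz' : z * star z = h := by
    simp only [hz, hh, star_add, star_mul, star_sub, star_one, hps, hqs]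
    simp only [mul_add, add_mul, mul_sub, sub_mul, mul_one, one_mul, mul_assoc, hpp, hqq, hq']
    abel
  have hzq : z * q = p * z := by
    simp only [hz, mul_add, add_mul, mul_sub, sub_mul, mul_one, one_mul, mul_assoc, hpp, hqq, hp']
    abel
  have hcq : Commute h q := by
    simp only [Commute, SemiconjBy, hh, mul_sub, sub_mul, mul_one, one_mul, mul_assoc, hpp, hqq,
      hq']
    abel
  have hcz : Commute h z := by
    rw [Commute, SemiconjBy, ← hzz]
    nth_rewrite 1 [hzz]
    rw [← hzz', mul_assoc]
  have hh1 : ‖h - 1‖ ≤ δ * δ := by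
    rw [hh, sub_sub_cancel_left, norm_neg]
    exact (norm_mul_le _ _).trans (mul_le_mul hpq hpq (norm_nonneg _) hδ0)
  obtain ⟨r, hrs, hrr, hr1, hrc⟩ := exists_inv_sqrt_near_one hsa (by nlinarith) hh1
  have hrz : Commute r z := hrc z hcz
  have hrq : Commute r q := hrc q hcq
  have huu : star (z * r) * (z * r) = 1 := by
    rw [star_mul, hrs, mul_assoc, ← mul_assoc (star z), hzz, ← mul_assoc, hrr]
  have huu' : (z * r) * star (z * r) = 1 := by
    rw [star_mul, hrs, ← hrz.eq]
    have : star z * r = r * star z := by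
      have := congrArg star hrz.eq
      rwa [star_mul, star_mul, hrs] at this
    rw [← this, mul_assoc, ← mul_assoc z, hzz', ← mul_assoc, hrr]
  refine ⟨z * r, Unitary.mem_iff.2 ⟨huu, huu'⟩, ?_, ?_⟩
  · rw [mul_assoc z r q, hrq.eq, ← mul_assoc z q r, hzq, mul_assoc p z r, mul_assoc p, huu',
      mul_one]
  · have hp1 : ‖p‖ ≤ 1 := hp.norm_le
    have hq1 : ‖q‖ ≤ 1 := hq.norm_le
    have hz1 : ‖z - 1‖ ≤ 2 * δ := by
      have : z - 1 = (p - q) * q - p * (p - q) := by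
        simp only [hz, mul_sub, sub_mul, mul_one, one_mul, hpp, hqq]; abel
      rw [this]
      refine (norm_sub_le _ _).trans ?_
      have h1 : ‖(p - q) * q‖ ≤ δ * 1 :=
        (norm_mul_le _ _).trans (mul_le_mul hpq hq1 (norm_nonneg _) hδ0)
      have h2 : ‖p * (p - q)‖ ≤ 1 * δ :=
        (norm_mul_le _ _).trans (mul_le_mul hp1 hpq (norm_nonneg _) zero_le_one)
      linarith
    have : z * r - 1 = (z - 1) * (r - 1) + (z - 1) + (r - 1) := by
      simp only [mul_sub, sub_mul, mul_one, one_mul]; abel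
    rw [this]
    -- The total is `2δ³ + 2δ + δ²`, which is at most `3δ` because `δ ≤ 1/2`.
    have h1 : ‖(z - 1) * (r - 1)‖ ≤ 2 * δ * (δ * δ) :=
      (norm_mul_le _ _).trans (mul_le_mul hz1 hr1 (norm_nonneg _) (by linarith))
    have h2 := norm_add₃_le (a := (z - 1) * (r - 1)) (b := z - 1) (c := r - 1)
    have h3 : δ * δ ≤ δ * (1 / 2) := mul_le_mul_of_nonneg_left hδ hδ0
    have h4 : δ * (δ * δ) ≤ δ * (1 / 4) :=
      mul_le_mul_of_nonneg_left (by nlinarith) hδ0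
    linarith

end Perturbation

/-! ### Criteria for and against uniform outerness -/

section UniformlyOuter

variable {A B : Type*} [CStarAlgebra A] [CStarAlgebra B]

theorem IsUniformlyOuter.autCongr {α : A ≃⋆ₐ[ℂ] A} (h : IsUniformlyOuter α)
    (θ : A ≃⋆ₐ[ℂ] B) : IsUniformlyOuter (autCongr θ α) := by
  intro a p hp hp0 ε hε
  obtain ⟨k, hk, q, hq, hqq, hsum, hn⟩ := h (θ.symm a) (θ.symm p) (hp.map θ.symm)
    (by simpa using hp0) ε hε
  refine ⟨k, hk, fun j => θ (q j), fun j => (hq j).map θ, fun j j' hj => ?_, ?_, fun j => ?_⟩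
  · rw [← map_mul, hqq j j' hj, map_zero]
  · rw [← map_sum, ← hsum, StarAlgEquiv.apply_symm_apply]
  · have : θ (q j) * a * UHF.autCongr θ α (θ (q j)) = θ (q j * θ.symm a * α (q j)) := by
      simp [UHF.autCongr]
    rw [this, StarAlgEquiv.norm_map]
    exact hn j

/-- An inner automorphism is not uniformly outer. -/
theorem not_isUniformlyOuter_of_inner [Nontrivial A] {α : A ≃⋆ₐ[ℂ] A} (w : unitary A)
    (hα : ∀ x, α x = w * x * star (w : A)) : ¬ IsUniformlyOuter α := by
  intro h
  obtain ⟨k, -, q, hq, -, hsum, hn⟩ := h (star (w : A)) 1 (.one A) one_ne_zero 1 one_pos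
  have hq0 : ∀ j, q j = 0 := fun j => by
    have h1 := hn j
    have hqj : q j * q j = q j := (hq j).isIdempotentElem
    have h2 : q j * star (w : A) * α (q j) = q j * star (w : A) := by
      rw [hα, mul_assoc (w : A), mul_assoc (q j), ← mul_assoc (star (w : A)),
        Unitary.coe_star_mul_self, one_mul, ← mul_assoc, hqj]
    rw [h2, ← Unitary.coe_star, CStarRing.norm_mul_coe_unitary] at h1
    have h3 : ‖q j‖ = ‖q j‖ * ‖q j‖ := by
      conv_lhs => rw [← hqj]
      nth_rewrite 1 [← (hq j).isSelfAdjoint.star_eq]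
      exact CStarRing.norm_star_mul_self
    by_contra h0
    have : 0 < ‖q j‖ := norm_pos_iff.2 h0
    nlinarith
  rw [Finset.sum_eq_zero fun j _ => hq0 j] at hsum
  exact one_ne_zero hsum

/-- Uniform outerness holds as soon as every pair of elements of a dense set commutes with a finite
partition of unity into projections which `α` moves to orthogonal ones. -/
theorem isUniformlyOuter_of_partition {α : A ≃⋆ₐ[ℂ] A}
    (h : ∀ a p : A, ∀ ε : ℝ, 0 < ε → ∃ a' p' : A, ‖a - a'‖ < ε ∧ ‖p - p'‖ < ε ∧
      ∃ k : ℕ, 0 < k ∧ ∃ e : Fin k → A,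
        (∀ j, IsStarProjection (e j)) ∧ (∀ j j', j ≠ j' → e j * e j' = 0) ∧ ∑ j, e j = 1 ∧
        ∀ j, Commute a' (e j) ∧ Commute p' (e j) ∧ e j * α (e j) = 0) :
    IsUniformlyOuter α := by
  intro a p hp _ ε hε
  have ha0 : 0 < 2 * ‖a‖ + 1 := by positivity
  -- The final error is `2‖a‖η` from moving the unitary past `a`, plus `η` from replacing `a` by
  -- `a'`.
  obtain ⟨η, hη0, hη⟩ : ∃ η : ℝ, 0 < η ∧ η * (2 * ‖a‖ + 1) < ε :=
    ⟨ε / 2 / (2 * ‖a‖ + 1), by positivity, by rw [div_mul_cancel₀ _ ha0.ne']; linarith⟩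
  -- The factor `21 = 7 · 3` makes up for the losses in the two perturbation lemmas; `1/40` is the
  -- threshold of the first.
  obtain ⟨a', b, ha', hb, k, hk, e, he, hee, hsum, hc⟩ :=
    h a p (min (min η (η / 21)) (1 / 40)) (by positivity)
  have ha : ‖a - a'‖ < η := ha'.trans_le ((min_le_left _ _).trans (min_le_left _ _))
  set δ := min (η / 21) (1 / 40) with hδ
  have hb' : ‖p - b‖ ≤ δ := hb.le.trans (min_le_min_right _ (min_le_right _ _))
  have hδ1 : δ ≤ 1 / 40 := min_le_right _ _
  have hδη : 3 * (7 * δ) ≤ η := by linarith [min_le_left (η / 21) (1 / 40 : ℝ)]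
  -- The real part is no farther from the self-adjoint `p`, and it still commutes with the
  -- self-adjoint `e j`.
  let s : A := (2⁻¹ : ℝ) • (b + star b)
  have hs : IsSelfAdjoint s := by
    simp [s, IsSelfAdjoint, add_comm]
  have hps : ‖p - s‖ ≤ δ := by
    have hps' : p - s = (2⁻¹ : ℝ) • ((p - b) + star (p - b)) := by
      have : p = (2⁻¹ : ℝ) • (p + p) := by
        rw [← two_smul ℝ p, smul_smul]; norm_num
      rw [star_sub, hp.isSelfAdjoint.star_eq]
      nth_rewrite 1 [this]
      simp only [s]
      rw [← smul_sub]
      congr 1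
      abel
    rw [hps', norm_smul]
    have h1 := norm_add_le (p - b) (star (p - b))
    rw [norm_star] at h1
    rw [Real.norm_of_nonneg (by norm_num)]
    linarith
  obtain ⟨q, hq, hpq, hqc⟩ := exists_isStarProjection_near hp hs hδ1 hps
  obtain ⟨u, hu, hconj, hu1⟩ := exists_unitary_conj_eq hp hq (by linarith) hpq
  replace hu1 := hu1.trans hδη
  have hqe : ∀ j, Commute q (e j) := fun j => by
    refine hqc _ ?_
    have h1 := (hc j).2.1
    have h2 := h1.star_star
    rw [(he j).isSelfAdjoint.star_eq] at h2
    exact (h1.add_left h2).smul_left _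
  have huu : star u * u = 1 := Unitary.star_mul_self_of_mem hu
  have hproj : ∀ j, IsStarProjection (q * e j) := fun j => by
    refine ⟨?_, ?_⟩
    · rw [IsIdempotentElem, mul_assoc, ← mul_assoc (e j), ← (hqe j).eq, mul_assoc q (e j),
        (he j).isIdempotentElem.eq, ← mul_assoc, hq.isIdempotentElem.eq]
    · rw [IsSelfAdjoint, star_mul, (he j).isSelfAdjoint.star_eq, hq.isSelfAdjoint.star_eq,
        (hqe j).eq]
  have hmul : ∀ x y : A, u * x * star u * (u * y * star u) = u * (x * y) * star u := fun x y => by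
    simp only [mul_assoc]
    rw [← mul_assoc (star u) u, huu, one_mul]
  refine ⟨k, hk, fun j => u * (q * e j) * star u, fun j => ⟨?_, ?_⟩, fun j j' hj => ?_, ?_,
    fun j => ?_⟩
  · rw [IsIdempotentElem, hmul, (hproj j).isIdempotentElem.eq]
  · exact (hproj j).isSelfAdjoint.conjugate u
  · rw [hmul, mul_assoc q, ← mul_assoc (e j), ← (hqe j).eq, mul_assoc q (e j), hee j j' hj]
    simp
  · rw [← Finset.sum_mul, ← Finset.mul_sum, ← Finset.mul_sum, hsum, mul_one, hconj]
  · have hαu : α u ∈ unitary A := Unitary.map_mem α hu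
    -- All dependence on `u` is absorbed into `c`, up to outer unitaries that do not affect the
    -- norm. Replacing `c` by `a'` gives exactly zero, as `e j` passes through `a'` to meet `α (e
    -- j)`; only `‖c - a'‖` remains.
    set c : A := star u * a * α u with hcdef
    have hca : ‖c - a'‖ < ε := by
      have h1 : c - a = star u * (a * (α u - 1) - (u - 1) * a) := by
        simp only [hcdef, mul_sub, sub_mul, mul_one, one_mul, ← mul_assoc, huu]; abel
      have h2 : ‖c - a‖ ≤ ‖a‖ * η + η * ‖a‖ := by
        rw [h1, CStarRing.norm_mem_unitary_mul _ (Unitary.star_mem hu)]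
        have h3 : ‖α u - 1‖ ≤ η := by
          rw [← map_one α, ← map_sub, StarAlgEquiv.norm_map]; exact hu1
        refine (norm_sub_le _ _).trans (add_le_add ?_ ?_)
        · exact (norm_mul_le _ _).trans (by gcongr)
        · exact (norm_mul_le _ _).trans (by gcongr)
      calc ‖c - a'‖ ≤ ‖c - a‖ + ‖a - a'‖ := norm_sub_le_norm_sub_add_norm_sub _ _ _
        _ < η * (2 * ‖a‖ + 1) := by linarith
        _ < ε := hη
    have hzero : q * e j * a' * α (q * e j) = 0 := by
      rw [(hqe j).eq, map_mul, ← (hqe j).eq, mul_assoc q, ← (hc j).1.eq]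
      simp only [mul_assoc]
      rw [← mul_assoc (e j), (hc j).2.2]
      simp
    have hexp : u * (q * e j) * star u * a * α (u * (q * e j) * star u) =
        u * (q * e j * (c - a') * α (q * e j)) * star (α u) := by
      rw [mul_sub, sub_mul, hzero, sub_zero]
      simp only [hcdef, map_mul, map_star, mul_assoc]
    rw [hexp, CStarRing.norm_mul_mem_unitary _ (Unitary.star_mem hαu),
      CStarRing.norm_mem_unitary_mul _ hu]
    have h1 : ‖q * e j‖ ≤ 1 := (hproj j).norm_le
    have h2 : ‖α (q * e j)‖ ≤ 1 := by rw [StarAlgEquiv.norm_map]; exact h1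
    refine lt_of_le_of_lt ?_ hca
    calc _ ≤ ‖q * e j‖ * ‖c - a'‖ * ‖α (q * e j)‖ :=
          (norm_mul_le _ _).trans (by gcongr; exact norm_mul_le _ _)
      _ ≤ 1 * ‖c - a'‖ * 1 := by gcongr
      _ = ‖c - a'‖ := by ring

end UniformlyOuter

/-! ### Product-type automorphisms of the UHF algebra -/

section ProductAction

variable {n : ℕ → ℕ} [∀ l, NeZero (n l)]

instance : Nontrivial (TensorAlg n) := by
  classical
  refine ⟨1, 0, fun h => ?_⟩
  have h1 := congrArg (toOp n) h
  rw [map_one, map_zero] at h1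
  have h2 := DFunLike.congr_fun h1 (lp.single 2 (0 : Config n) (1 : ℂ))
  have h3 := congrArg (fun f : Hil n => f 0) h2
  simp at h3

/-- Elements commuting with all but finitely many tensor factors are dense. -/
theorem exists_local_near (x : TensorAlg n) {ε : ℝ} (hε : 0 < ε) :
    ∃ y : TensorAlg n, ‖x - y‖ < ε ∧ ∃ L, ∀ l, L ≤ l → ∀ m, Commute y (factor n l m) := by
  obtain ⟨b, hb, hxb⟩ := Metric.mem_closure_iff.1
    (show toOp n x ∈ closure ((⨆ l, (siteHom n l).range :
      StarSubalgebra ℂ (Hil n →L[ℂ] Hil n)) : Set (Hil n →L[ℂ] Hil n)) from x.2) ε hε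
  obtain ⟨L, hL⟩ := iSup_range_le_localOps hb
  let y : TensorAlg n := ⟨b, StarSubalgebra.le_topologicalClosure _ hb⟩
  refine ⟨y, ?_, L, fun l hl m => toOp_injective n ?_⟩
  · rw [← norm_toOp, map_sub, ← dist_eq_norm]
    exact hxb
  · rw [map_mul, map_mul, toOp_factor]
    exact (hL l hl m).symm.eq

/-- The partial conjugations are constant from stage `l + 1` on, and the unitaries at sites before
`l` commute with the `l`-th factor and cancel. -/
theorem Ad_factor (u : ∀ l, unitary (Mat (n l))) (l : ℕ) (m : Mat (n l)) :
    Ad n u (factor n l m) = factor n l (u l * m * star (u l : Mat (n l))) := by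
  refine adFun_eq (tendsto_const_nhds.congr' ?_)
  filter_upwards [Filter.eventually_ge_atTop (l + 1)] with M hM
  rw [partialAd_eq_of_local u (L := l + 1) (fun k hk m' => by
    rw [toOp_factor]; exact siteHom_commute (by omega) m' m) hM, partialAd,
    Unitary.conjStarAlgAut_apply]
  have hv : (partialUnitary u (l + 1) : TensorAlg n) =
      partialUnitary u l * factor n l (u l : Mat (n l)) := rfl
  have hc := partialUnitary_commute u le_rfl ((u l : Mat (n l)) * m * star (u l : Mat (n l)))
  rw [map_mul, map_mul, map_star] at hc
  rw [hv, star_mul, map_mul, map_mul, map_star]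
  have h1 : (partialUnitary u l : TensorAlg n) * star (partialUnitary u l : TensorAlg n) = 1 :=
    Unitary.coe_mul_star_self (partialUnitary u l)
  generalize factor n l (u l : Mat (n l)) = v at hc
  generalize (partialUnitary u l : TensorAlg n) = w at hc h1
  generalize factor n l m = y at hc
  calc v * y * star v = v * y * star v * (w * star w) := by rw [h1, mul_one]
    _ = w * (v * y * star v) * star w := by rw [hc.eq, mul_assoc (v * y * star v)]
    _ = w * v * y * (star v * star w) := by simp only [mul_assoc]

/-- The partial products stabilise at stage `L`, so the limit defining `Ad` is that of an eventually
constant sequence. -/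
theorem Ad_eq_conj (u : ∀ l, unitary (Mat (n l))) {L : ℕ} (hu : ∀ l, L ≤ l → u l = 1)
    (x : TensorAlg n) :
    Ad n u x = partialUnitary u L * x * star (partialUnitary u L : TensorAlg n) := by
  refine adFun_eq (tendsto_const_nhds.congr' ?_)
  filter_upwards [Filter.eventually_ge_atTop L] with M hM
  have : partialUnitary u M = partialUnitary u L := by
    induction M, hM using Nat.le_induction with
    | base => rfl
    | succ M hM ih => rw [partialUnitary, hu M hM, map_one, mul_one, ih]
  rw [partialAd, Unitary.conjStarAlgAut_apply, this]

theorem cyclicRep_conj_single {k : ℕ} [NeZero k] (g : Multiplicative (ZMod k)) (j : ZMod k) :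
    (cyclicRep k g : Mat k) * Matrix.single j j 1 * star (cyclicRep k g : Mat k) =
      Matrix.single (g.toAdd + j) (g.toAdd + j) 1 := by
  ext a b
  rw [Matrix.mul_apply, Finset.sum_eq_single j]
  · rw [Matrix.mul_single_apply_same]
    by_cases ha : a = g.toAdd + j <;> by_cases hb : b = g.toAdd + j <;>
      simp [cyclicRep, Matrix.star_apply, ha, hb, eq_comm]
  · intro x _ hx
    rw [Matrix.mul_single_apply_of_ne _ _ _ _ _ hx, zero_mul]
  · simp

/-- If infinitely many coordinates of `g` are nonzero, the product of the translations by `g` is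
uniformly outer. -/
theorem isUniformlyOuter_Ad_productRep (g : ∀ l, ZMod (n l)) (hg : ∀ L, ∃ l, L ≤ l ∧ g l ≠ 0) :
    IsUniformlyOuter (Ad n (productRep n (Multiplicative.ofAdd g))) := by
  refine isUniformlyOuter_of_partition fun a p ε hε => ?_
  obtain ⟨a', ha', L, hL⟩ := exists_local_near a hε
  obtain ⟨p', hp', M, hM⟩ := exists_local_near p hε
  -- Beyond both `L` and `M` the whole factor at `l` commutes with `a'` and `p'`, so its diagonal
  -- matrix units serve as the partition.
  obtain ⟨l, hl, hgl⟩ := hg (max L M)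
  let φ := (Fintype.equivFin (ZMod (n l))).symm
  have horth : ∀ j j' : ZMod (n l), j ≠ j' →
      factor n l (Matrix.single j j 1) * factor n l (Matrix.single j' j' 1) = 0 :=
    fun j j' hj => by
      rw [← map_mul, Matrix.single_mul_single_of_ne _ _ _ _ hj, map_zero]
  refine ⟨a', p', ha', hp', _, Fintype.card_pos, fun j => factor n l (Matrix.single (φ j) (φ j) 1),
    fun j => IsStarProjection.map ⟨?_, ?_⟩ (factor n l), fun j j' hj => ?_, ?_,
    fun j => ⟨hL l (le_of_max_le_left hl) _, hM l (le_of_max_le_right hl) _, ?_⟩⟩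
  · simp [IsIdempotentElem]
  · simp [IsSelfAdjoint, Matrix.star_eq_conjTranspose]
  · exact horth _ _ (φ.injective.ne hj)
  · rw [φ.sum_comp (fun j => factor n l (Matrix.single j j 1)), ← map_sum,
      Matrix.sum_single_one, map_one]
  · rw [Ad_factor]
    have : (productRep n (Multiplicative.ofAdd g) l) =
      cyclicRep (n l) (Multiplicative.ofAdd (g l)) := rfl
    rw [this, cyclicRep_conj_single]
    exact horth _ _ (by simpa using hgl)

/-- If only finitely many coordinates of `g` are nonzero, the product of the translations by `g` is
inner, hence not uniformly outer. -/
theorem not_isUniformlyOuter_Ad_productRep (g : ∀ l, ZMod (n l)) {L : ℕ}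
    (hg : ∀ l, L ≤ l → g l = 0) :
    ¬ IsUniformlyOuter (Ad n (productRep n (Multiplicative.ofAdd g))) := by
  refine not_isUniformlyOuter_of_inner _ (Ad_eq_conj _ (L := L) fun l hl => ?_)
  change cyclicRep (n l) (Multiplicative.ofAdd (g l)) = 1
  rw [hg l hl, ofAdd_zero, map_one]

theorem isUniformlyOuter_autCongr_iff {A B : Type*} [CStarAlgebra A] [CStarAlgebra B]
    {α : A ≃⋆ₐ[ℂ] A} (θ : A ≃⋆ₐ[ℂ] B) : IsUniformlyOuter (autCongr θ α) ↔ IsUniformlyOuter α := by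
  refine ⟨fun h => ?_, fun h => h.autCongr θ⟩
  convert h.autCongr θ.symm
  ext x
  simp [autCongr]

/-- The direct sum consists of the elements of the product that vanish from some index on. -/
theorem mem_range_coeFnAddMonoidHom_iff {M : ℕ → Type*} [∀ l, AddCommGroup (M l)] (g : ∀ l, M l) :
    g ∈ (DirectSum.coeFnAddMonoidHom M).range ↔ ∃ L, ∀ l, L ≤ l → g l = 0 := by
  classical
  constructor
  · rintro ⟨x, rfl⟩
    obtain ⟨L, hL⟩ := (DFinsupp.support x).exists_nat_subset_range
    refine ⟨L, fun l hl => ?_⟩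
    by_contra h
    have := hL (DFinsupp.mem_support_iff.2 h)
    simp at this
    omega
  · rintro ⟨L, hL⟩
    refine ⟨DFinsupp.mk (Finset.range L) fun l => g l, ?_⟩
    ext l
    rw [DirectSum.coeFnAddMonoidHom_apply]
    refine (DFinsupp.mk_apply).trans ?_
    split_ifs with h
    · rfl
    · exact (hL l (by simpa using h)).symm

end ProductAction

end UHF

/-! ### The equivalence for the model action -/

theorem mainTheorem6 (n : ℕ → ℕ) [∀ l, NeZero (n l)] (θ : UHF.TensorAlg n ≃⋆ₐ[ℂ] UHF.Q)
    {G : Type*} [AddCommGroup G] (i : G →+ ∀ l, ZMod (n l)) (hi : Function.Injective i) :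
    UHF.IsUniformlyOuterAction (UHF.modelAction n θ i) ↔
      i.range ⊓ (DirectSum.coeFnAddMonoidHom fun l => ZMod (n l)).range = ⊥ := by
  have key : ∀ g : G, UHF.IsUniformlyOuter (UHF.modelAction n θ i (Multiplicative.ofAdd g)) ↔
      i g ∉ (DirectSum.coeFnAddMonoidHom fun l => ZMod (n l)).range := fun g => by
    rw [UHF.mem_range_coeFnAddMonoidHom_iff]
    refine (UHF.isUniformlyOuter_autCongr_iff
      (α := UHF.Ad n (UHF.productRep n (Multiplicative.ofAdd (i g)))) θ).trans ⟨?_, fun h => ?_⟩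
    · rintro h ⟨L, hL⟩
      exact UHF.not_isUniformlyOuter_Ad_productRep (i g) hL h
    · push Not at h
      exact UHF.isUniformlyOuter_Ad_productRep (i g) h
  rw [AddSubgroup.eq_bot_iff_forall]
  constructor
  · rintro h _ ⟨⟨g, rfl⟩, hg⟩
    by_contra h0
    refine (key g).1 (h (Multiplicative.ofAdd g) fun h1 => h0 ?_) hg
    rw [ofAdd_eq_one.1 h1, map_zero]
  -- Only this direction needs injectivity: a trivial intersection gives `i g = 0`, which must force
  -- `g = 0`.
  · intro h g hg
    refine (key g.toAdd).2 fun hmem => hg ?_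
    have := h (i g.toAdd) ⟨⟨_, rfl⟩, hmem⟩
    exact toAdd_eq_zero.1 ((map_eq_zero_iff i hi).1 this)
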